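/- Let $\mathbb{B}^*$ be the set of finite binary strings and write $\ell(p)$ for the length of $p$. A conditional prefix machine is a partial computable function $(p,y)\mapsto U(p,y)$ from $\mathbb{B}^*\times\mathbb{B}^*$ to $\mathbb{B}^*$ such that for every $y$ the set of $p$ for which $U(p,y)$ is defined is prefix-free. Let $U$ be an optimal conditional prefix machine, that is, for every conditional prefix machine $V$ there is a constant $b$ such that whenever $V(p,y)=x$ there is $q$ with $U(q,y)=x$ and $\ell(q)\le\ell(p)+b$ (for example, a universal prefix Turing machine). Let $K(x|y)=\min\{\ell(p):U(p,y)=x\}$ be the conditional prefix Kolmogorov complexity. For a real constant $c\ge 0$ let $d_K(x,y)=\max\{K(x|y),K(y|x)\}+c$ for $x\ne y$ and $d_K(x,x)=0$ (this is a metric for all sufficiently large $c$). Then for every real $\alpha>\log_4(3/2)\approx 0.292$ (in particular for every $\alpha>0.3$), $d_K^\alpha$ is not Euclidean: there are no real Hilbert space $H$ and map $\Phi:\mathbb{B}^*\to H$ with $d_K(x,y)^\alpha=\|\Phi(x)-\Phi(y)\|$ for all $x,y\in\mathbb{B}^*$. The same holds if the maximum in the definition of $d_K$ is replaced by the average $\frac12\big(K(x|y)+K(y|x)\big)$.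 -/

import Mathlib

universe u v

namespace AlgInfoDistance

/-- A conditional prefix machine: `U p y` is the (possibly undefined) output of the machine on the
binary program `p` with side information `y`. It is partial computable, and for every `y` the set
of halting programs is prefix-free. -/
structure IsPrefixMachine (U : List Bool → List Bool →. List Bool) : Prop where
  partrec : Partrec₂ U
  prefixFree : ∀ y p q : List Bool, (U p y).Dom → (U q y).Dom → p <+: q → p = q

/-- An (additively) optimal prefix machine: every prefix machine `V` is simulated by `U` with
programs that are longer by at most a constant depending only on `V`. Every universal prefix
Turing machine, which simulates `V` by prepending a fixed string to the programs of `V`,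
has this property. -/
structure IsOptimalPrefixMachine (U : List Bool → List Bool →. List Bool) : Prop where
  isPrefixMachine : IsPrefixMachine U
  optimal : ∀ V : List Bool → List Bool →. List Bool, IsPrefixMachine V →
    ∃ b : ℕ, ∀ p y x : List Bool, x ∈ V p y → ∃ q : List Bool, x ∈ U q y ∧ q.length ≤ p.length + b

/-- The conditional Kolmogorov complexity `K(x|y) = min {ℓ(p) : U(p, y) = x}`. -/
noncomputable def condK (U : List Bool → List Bool →. List Bool) (x y : List Bool) : ℕ :=
  sInf {n : ℕ | ∃ p : List Bool, x ∈ U p y ∧ p.length = n}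

/-- For an optimal machine the minimum in the definition of `condK` is over a nonempty set. -/
theorem IsOptimalPrefixMachine.exists_program {U : List Bool → List Bool →. List Bool}
    (hU : IsOptimalPrefixMachine U) (x y : List Bool) :
    ∃ p : List Bool, x ∈ U p y ∧ p.length = condK U x y := by
  suffices h : {n : ℕ | ∃ p : List Bool, x ∈ U p y ∧ p.length = n}.Nonempty from Nat.sInf_mem h
  let V : List Bool → List Bool →. List Bool :=
    fun p _ => ((if p = [] then some x else none : Option (List Bool)) : Part (List Bool))
  have hV : IsPrefixMachine V := by
    refine ⟨?_, ?_⟩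
    · have h1 : Primrec (fun a : List Bool × List Bool =>
          (if a.1 = [] then some x else none : Option (List Bool))) :=
        Primrec.ite (PrimrecRel.comp Primrec.eq Primrec.fst (Primrec.const []))
          (Primrec.const _) (Primrec.const _)
      exact h1.to_comp.ofOption
    · intro y p q hp hq _
      have key : ∀ r : List Bool, (V r y).Dom → r = [] := by
        intro r hr
        by_contra hne
        simp [V, hne] at hr
      rw [key p hp, key q hq]
  obtain ⟨b, hb⟩ := hU.optimal V hV
  obtain ⟨q, hq, -⟩ := hb [] y x (by simp [V])
  exact ⟨q.length, q, hq, rfl⟩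

/-- The complexity distance `max {K(x|y), K(y|x)} + c` for `x ≠ y`, and `0` for `x = y`. -/
noncomputable def dKMax (U : List Bool → List Bool →. List Bool) (c : ℝ) (x y : List Bool) : ℝ :=
  if x = y then 0 else max (condK U x y : ℝ) (condK U y x : ℝ) + c

/-- The averaged variant `(K(x|y) + K(y|x)) / 2 + c` for `x ≠ y`, and `0` for `x = y`. -/
noncomputable def dKAvg (U : List Bool → List Bool →. List Bool) (c : ℝ) (x y : List Bool) : ℝ :=
  if x = y then 0 else ((condK U x y : ℝ) + (condK U y x : ℝ)) / 2 + c

/-- A kernel `k` on `X` is Euclidean if `k x y = ‖Φ x - Φ y‖` for some map `Φ` of `X` into a real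
Hilbert space. -/
def IsEuclidean {X : Type u} (k : X → X → ℝ) : Prop :=
  ∃ (H : Type v) (_ : NormedAddCommGroup H) (_ : InnerProductSpace ℝ H) (_ : CompleteSpace H)
    (Φ : X → H), ∀ x y : X, k x y = ‖Φ x - Φ y‖

end AlgInfoDistance

namespace AlgInfoDistance

/-! ### Complexity bounds -/

/-! Take a `2 × 2` matrix of bit strings of length `n`, and the six points formed by its rows, its
columns and the xor sums of each pair. A row-type line and a column-type line share one linear form
of the matrix, so each is computable from the other with `n + O(1)` bits
(`exists_condK_lineWord_le`). Two parallel lines determine the whole matrix, so by counting some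
matrix gives them conditional complexity about `2n` (`exists_lt_condK_lineWord`). The negative-type
inequality for two triples in a Hilbert space (`sum_parallel_le_sum_crossing`) then gives `12
(2n)^(2α) ≤ 18 n^(2α)` asymptotically, that is `4^α ≤ 3/2`. -/

theorem condK_le {U : List Bool → List Bool →. List Bool} {p x y : List Bool} (h : x ∈ U p y) :
    condK U x y ≤ p.length :=
  Nat.sInf_le ⟨p, h, rfl⟩

/-- Bits of a string, padded by `false`, determine it among programs of a prefix machine. -/
theorem IsPrefixMachine.eq_of_getD_eq {U : List Bool → List Bool →. List Bool}
    (hU : IsPrefixMachine U) {y p q : List Bool} {k : ℕ} (hp : (U p y).Dom) (hq : (U q y).Dom)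
    (hpk : p.length ≤ k) (hqk : q.length ≤ k)
    (h : ∀ i < k, p.getD i false = q.getD i false) : p = q := by
  have aux : ∀ {p q : List Bool}, (U p y).Dom → (U q y).Dom → p.length ≤ k → q.length ≤ k →
      (∀ i < k, p.getD i false = q.getD i false) → p.length ≤ q.length → p = q := by
    intro p q hp hq hpk hqk h hle
    refine hU.prefixFree y p q hp hq (List.prefix_iff_getElem.2 ⟨hle, fun i hi => ?_⟩)
    have := h i (by omega)
    rwa [List.getD_eq_getElem _ _ hi, List.getD_eq_getElem _ _ (by omega)] at this
  rcases le_total p.length q.length with hle | hle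
  · exact aux hp hq hpk hqk h hle
  · exact (aux hq hp hqk hpk (fun i hi => (h i hi).symm) hle).symm

/-- At most `2 ^ k` strings have conditional complexity at most `k`. -/
theorem IsOptimalPrefixMachine.card_le {U : List Bool → List Bool →. List Bool}
    (hU : IsOptimalPrefixMachine U) {ι : Type*} [Fintype ι] [DecidableEq ι] (f : ι → List Bool)
    (hf : Function.Injective f) (y : List Bool) (k : ℕ) :
    (Finset.univ.filter fun i => condK U (f i) y ≤ k).card ≤ 2 ^ k := by
  choose p hp hlen using fun i => hU.exists_program (f i) y
  have hcard : (Finset.univ : Finset (Fin k → Bool)).card = 2 ^ k := by simp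
  rw [← hcard]
  refine Finset.card_le_card_of_injOn (fun i (j : Fin k) => (p i).getD j false)
    (fun _ _ => Finset.mem_coe.2 (Finset.mem_univ _)) ?_
  intro i hi j hj hij
  simp only [Finset.coe_filter, Finset.mem_univ, true_and, Set.mem_ofPred_eq] at hi hj
  have hpq : p i = p j := hU.isPrefixMachine.eq_of_getD_eq (Part.dom_iff_mem.2 ⟨_, hp i⟩)
    (Part.dom_iff_mem.2 ⟨_, hp j⟩) (by rw [hlen]; exact hi) (by rw [hlen]; exact hj)
    (fun a ha => congrFun hij ⟨a, ha⟩)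
  exact hf (Part.mem_unique (hp i) (hpq ▸ hp j))

/-- A computable injective encoding of lists of pairs of bits as strings. -/
def codeList (v : List (Bool × Bool)) : List Bool :=
  List.replicate (Encodable.encode v) true

theorem codeList_injective : Function.Injective codeList := by
  intro v w h
  have := congrArg List.length h
  simpa [codeList] using this

/-- Applies `h` entrywise to a program and a list of pairs of bits. -/
def mapBits (h : Bool × (Bool × Bool) → Bool × Bool) (p : List Bool) (v : List (Bool × Bool)) :
    List (Bool × Bool) :=
  (List.range p.length).map fun i => h (p.getD i false, v.getD i (false, false))

theorem primrec_mapBits (h : Bool × (Bool × Bool) → Bool × Bool) : Primrec₂ (mapBits h) := by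
  refine Primrec.list_map (Primrec.list_range.comp (Primrec.list_length.comp Primrec.fst)) ?_
  exact (Primrec.dom_finite h).comp (Primrec.pair
    ((Primrec.list_getD false).comp (Primrec.fst.comp Primrec.fst) Primrec.snd)
    ((Primrec.list_getD (false, false)).comp (Primrec.snd.comp Primrec.fst) Primrec.snd))

theorem primrec_codeList : Primrec codeList := by
  have : Primrec fun v : List (Bool × Bool) =>
      (List.range (Encodable.encode v)).map fun _ => true :=
    Primrec.list_map (Primrec.list_range.comp Primrec.encode) (Primrec.const true).to₂
  refine this.of_eq fun v => ?_
  simp [codeList, List.map_const']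

theorem mapBits_ofFn (h : Bool × (Bool × Bool) → Bool × Bool) {n : ℕ} (p : Fin n → Bool)
    (v : Fin n → Bool × Bool) :
    mapBits h (List.ofFn p) (List.ofFn v) = List.ofFn fun i => h (p i, v i) := by
  apply List.ext_getElem
  · simp [mapBits]
  · intro i h1 h2
    have hi : i < n := by simpa using h2
    simp [mapBits, hi]

/-- Entrywise modifications by `n` program bits of a coded list of length `n` cost `n + O(1)`. -/
theorem IsOptimalPrefixMachine.exists_condK_mapBits_le {U : List Bool → List Bool →. List Bool}
    (hU : IsOptimalPrefixMachine U) (h : Bool × (Bool × Bool) → Bool × Bool) :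
    ∃ b : ℕ, ∀ (n : ℕ) (p : Fin n → Bool) (v : Fin n → Bool × Bool),
      condK U (codeList (List.ofFn fun i => h (p i, v i))) (codeList (List.ofFn v)) ≤ n + b := by
  -- Requiring the program to be as long as the list decoded from `y` makes all halting programs for
  -- a given `y` equally long: prefix-freeness costs no extra bits. The unary coding is harmless, as
  -- only conditional complexities occur.
  let V₀ : List Bool → List Bool → Option (List Bool) := fun p y =>
    (Encodable.decode (α := List (Bool × Bool)) y.length).bind fun v =>
      if v.length = p.length then some (codeList (mapBits h p v)) else none
  have hV₀ : Primrec₂ V₀ := by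
    refine Primrec.option_bind (Primrec.decode.comp (Primrec.list_length.comp Primrec.snd)) ?_
    refine Primrec.ite (PrimrecRel.comp Primrec.eq (Primrec.list_length.comp Primrec.snd)
      (Primrec.list_length.comp (Primrec.fst.comp Primrec.fst))) ?_ (Primrec.const _)
    exact Primrec.option_some.comp (primrec_codeList.comp
      ((primrec_mapBits h).comp (Primrec.fst.comp Primrec.fst) Primrec.snd))
  have hV : IsPrefixMachine fun p y => (V₀ p y : Part (List Bool)) := by
    refine ⟨hV₀.to_comp.ofOption, ?_⟩
    have key : ∀ y r : List Bool, ((V₀ r y : Part (List Bool))).Dom →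
        ∃ v, Encodable.decode (α := List (Bool × Bool)) y.length = some v ∧
          v.length = r.length := by
      intro y r hr
      obtain ⟨x, hx⟩ := Part.dom_iff_mem.1 hr
      rw [Part.mem_coe] at hx
      obtain ⟨v, hv, hx⟩ := Option.bind_eq_some_iff.1 hx
      refine ⟨v, hv, ?_⟩
      by_contra hne
      simp [hne] at hx
    intro y p q hp hq hpq
    obtain ⟨v, hv, hvp⟩ := key y p hp
    obtain ⟨w, hw, hwq⟩ := key y q hq
    rw [hv, Option.some_inj] at hw
    exact hpq.eq_of_length (by rw [← hvp, ← hwq, hw])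
  obtain ⟨b, hb⟩ := hU.optimal _ hV
  refine ⟨b, fun n p v => ?_⟩
  obtain ⟨q, hq, hlen⟩ := hb (List.ofFn p) (codeList (List.ofFn v))
    (codeList (List.ofFn fun i => h (p i, v i))) (by
      rw [Part.mem_coe]
      simp [V₀, codeList, mapBits_ofFn])
  exact (condK_le hq).trans (by simpa using hlen)

/-! ### Rows and columns of a matrix of strings -/

/-- The two rows of a `2 × 2` matrix of bits and their sum (first index `false`), and the two
columns and their sum (first index `true`). -/
def line : Bool → Fin 3 → (Bool × Bool) × (Bool × Bool) → Bool × Bool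
  | false, i, m => ![m.1, m.2, (m.1.1 ^^ m.2.1, m.1.2 ^^ m.2.2)] i
  | true, i, m => ![(m.1.1, m.2.1), (m.1.2, m.2.2), (m.1.1 ^^ m.1.2, m.2.1 ^^ m.2.2)] i

theorem line_injective : ∀ (s : Bool) (i j : Fin 3), i ≠ j →
    ∀ m m', line s i m = line s i m' → line s j m = line s j m' → m = m' := by
  decide

/-- The component of a line not needed to recover the `i`-th crossing line. -/
def newBit (i : Fin 3) (x : Bool × Bool) : Bool := ![x.2, x.1, x.1] i

/-- Recovers the `i`-th line from one additional bit and the `j`-th crossing line. -/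
def recover (i j : Fin 3) (x : Bool × (Bool × Bool)) : Bool × Bool :=
  let t := ![x.2.1, x.2.2, x.2.1 ^^ x.2.2] i
  ![(t, x.1), (x.1, t), (x.1, x.1 ^^ t)] j

/-- The `j`-th coordinate of line `i` equals the `i`-th coordinate of the crossing line `j`, the
third coordinate of a pair being its xor; one more bit fixes the line. -/
theorem recover_line : ∀ (s : Bool) (i j : Fin 3) (m),
    recover i j (newBit j (line s i m), line (!s) j m) = line s i m := by
  decide

/-- The string coding a line of a matrix of strings of length `n`. -/
def lineWord {n : ℕ} (s : Bool) (i : Fin 3) (m : Fin n → (Bool × Bool) × (Bool × Bool)) :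
    List Bool :=
  codeList (List.ofFn fun a => line s i (m a))

theorem IsOptimalPrefixMachine.exists_condK_lineWord_le {U : List Bool → List Bool →. List Bool}
    (hU : IsOptimalPrefixMachine U) :
    ∃ b : ℕ, ∀ (n : ℕ) (m : Fin n → (Bool × Bool) × (Bool × Bool)) (s : Bool) (i j : Fin 3),
      condK U (lineWord s i m) (lineWord (!s) j m) ≤ n + b := by
  choose b hb using fun ij : Fin 3 × Fin 3 => hU.exists_condK_mapBits_le (recover ij.1 ij.2)
  refine ⟨Finset.univ.sup b, fun n m s i j => ?_⟩
  have := hb (i, j) n (fun a => newBit j (line s i (m a))) (fun a => line (!s) j (m a))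
  simp only [recover_line] at this
  exact this.trans (Nat.add_le_add_left (Finset.le_sup (f := b) (Finset.mem_univ (i, j))) n)

/-- Used to show that parallel words are distinct: equal ones would violate the lower bound near
`2n`. -/
theorem IsOptimalPrefixMachine.exists_condK_lineWord_self_le
    {U : List Bool → List Bool →. List Bool} (hU : IsOptimalPrefixMachine U) :
    ∃ b : ℕ, ∀ (n : ℕ) (m : Fin n → (Bool × Bool) × (Bool × Bool)) (s : Bool) (i : Fin 3),
      condK U (lineWord s i m) (lineWord s i m) ≤ n + b := by
  obtain ⟨b, hb⟩ := hU.exists_condK_mapBits_le Prod.snd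
  exact ⟨b, fun n m s i => hb n (fun _ => false) fun a => line s i (m a)⟩

/-- The number of matrices for which two given parallel lines have small complexity. -/
theorem IsOptimalPrefixMachine.card_lineWord_le {U : List Bool → List Bool →. List Bool}
    (hU : IsOptimalPrefixMachine U) (n k : ℕ) (s : Bool) {i j : Fin 3} (hij : i ≠ j) :
    (Finset.univ.filter fun m : Fin n → (Bool × Bool) × (Bool × Bool) =>
      condK U (lineWord s i m) (lineWord s j m) ≤ k).card ≤ 4 ^ n * 2 ^ k := by
  let W : (Fin n → Bool × Bool) → List Bool := fun v => codeList (List.ofFn v)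
  have hW : Function.Injective W := codeList_injective.comp List.ofFn_injective
  have hsig : ((Finset.univ : Finset (Fin n → Bool × Bool)).sigma fun y =>
      Finset.univ.filter fun x => condK U (W x) (W y) ≤ k).card ≤ 4 ^ n * 2 ^ k := by
    rw [Finset.card_sigma]
    refine (Finset.sum_le_card_nsmul _ _ _ fun y _ => hU.card_le W hW (W y) k).trans ?_
    simp
  -- A matrix is determined by its two lines: `4 ^ n` choices for the condition, then at most `2 ^
  -- k` for the other line.
  refine le_trans (Finset.card_le_card_of_injOn
    (fun m => ⟨fun a => line s j (m a), fun a => line s i (m a)⟩) ?_ ?_) hsig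
  · intro m hm
    exact Finset.mem_coe.2 (Finset.mem_sigma.2 ⟨Finset.mem_univ _,
      Finset.mem_filter.2 ⟨Finset.mem_univ _, (Finset.mem_filter.1 (Finset.mem_coe.1 hm)).2⟩⟩)
  · intro m _ m' _ h
    simp only [Sigma.mk.injEq, heq_eq_eq] at h
    funext a
    exact line_injective s i j hij _ _ (congrFun h.2 a) (congrFun h.1 a)

/-- Union bound over the 12 ordered parallel pairs. The shift by 2 suffices because `12 * 4 ^ 2 < 16
^ 2`. -/
theorem IsOptimalPrefixMachine.exists_lt_condK_lineWord
    {U : List Bool → List Bool →. List Bool} (hU : IsOptimalPrefixMachine U) (k : ℕ) :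
    ∃ m : Fin (k + 2) → (Bool × Bool) × (Bool × Bool), ∀ (s : Bool) (i j : Fin 3), i ≠ j →
      2 * k < condK U (lineWord s i m) (lineWord s j m) := by
  by_contra! hcon
  let T : Finset (Bool × Fin 3 × Fin 3) := Finset.univ.filter fun t => t.2.1 ≠ t.2.2
  have hT : T.card = 12 := by decide
  have hcover : (Finset.univ : Finset (Fin (k + 2) → (Bool × Bool) × (Bool × Bool))) ⊆
      T.biUnion fun t => Finset.univ.filter fun m =>
        condK U (lineWord t.1 t.2.1 m) (lineWord t.1 t.2.2 m) ≤ 2 * k := by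
    intro m _
    obtain ⟨s, i, j, hij, h⟩ := hcon m
    exact Finset.mem_biUnion.2 ⟨(s, i, j), by simpa [T] using hij, by simpa using h⟩
  have h1 := (Finset.card_le_card hcover).trans (Finset.card_biUnion_le_card_mul T _ _
    fun t ht => hU.card_lineWord_le (k + 2) (2 * k) t.1 (Finset.mem_filter.1 ht).2)
  have h2 : (Finset.univ : Finset (Fin (k + 2) → (Bool × Bool) × (Bool × Bool))).card
      = 16 ^ (k + 2) := by simp
  have h3 : (16 : ℕ) ^ k = 4 ^ k * 4 ^ k := by rw [← mul_pow]; norm_num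
  rw [h2, hT, pow_mul, pow_add, pow_add, h3] at h1
  norm_num at h1
  have : 0 < 4 ^ k * 4 ^ k := by positivity
  nlinarith

/-! ### The six-point inequality -/

/-- The right side minus the left is `2 ‖∑ x i - ∑ y i‖ ^ 2`. -/
theorem sum_parallel_le_sum_crossing {H : Type*} [NormedAddCommGroup H] [InnerProductSpace ℝ H]
    (x y : Fin 3 → H) :
    ∑ i, ∑ j, ‖x i - x j‖ ^ 2 + ∑ i, ∑ j, ‖y i - y j‖ ^ 2 ≤ 2 * ∑ i, ∑ j, ‖x i - y j‖ ^ 2 := by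
  have h : 0 ≤ ‖(x 0 + x 1 + x 2) - (y 0 + y 1 + y 2)‖ ^ 2 := sq_nonneg _
  simp only [Fin.sum_univ_three, ← real_inner_self_eq_norm_sq, inner_sub_left, inner_sub_right,
    inner_add_left, inner_add_right] at h ⊢
  linarith [real_inner_comm (x 0) (x 1), real_inner_comm (x 0) (x 2), real_inner_comm (x 1) (x 2),
    real_inner_comm (y 0) (y 1), real_inner_comm (y 0) (y 2), real_inner_comm (y 1) (y 2),
    real_inner_comm (x 0) (y 0), real_inner_comm (x 0) (y 1), real_inner_comm (x 0) (y 2),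
    real_inner_comm (x 1) (y 0), real_inner_comm (x 1) (y 1), real_inner_comm (x 1) (y 2),
    real_inner_comm (x 2) (y 0), real_inner_comm (x 2) (y 1), real_inner_comm (x 2) (y 2)]

theorem mul_sq_le_of_isEuclidean {X : Type u} {k : X → X → ℝ} (hk : IsEuclidean.{u, v} k)
    (w : Bool → Fin 3 → X) {t r : ℝ} (ht : 0 ≤ t)
    (hpar : ∀ s i j, i ≠ j → t ≤ k (w s i) (w s j)) (hcross : ∀ i j, k (w false i) (w true j) ≤ r) :
    2 * t ^ 2 ≤ 3 * r ^ 2 := by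
  obtain ⟨H, _, _, _, Φ, hΦ⟩ := hk
  have h := sum_parallel_le_sum_crossing (fun i => Φ (w false i)) (fun i => Φ (w true i))
  have h0 : ∀ s i, ‖Φ (w s i) - Φ (w s i)‖ = 0 := by simp
  have hlow : ∀ s i j, i ≠ j → t ^ 2 ≤ ‖Φ (w s i) - Φ (w s j)‖ ^ 2 := fun s i j hij =>
    pow_le_pow_left₀ ht ((hpar s i j hij).trans_eq (hΦ _ _)) 2
  have hupp : ∀ i j, ‖Φ (w false i) - Φ (w true j)‖ ^ 2 ≤ r ^ 2 := fun i j =>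
    pow_le_pow_left₀ (norm_nonneg _) ((hΦ _ _).symm.trans_le (hcross i j)) 2
  have hpar' : ∀ s, 6 * t ^ 2 ≤ ∑ i, ∑ j, ‖Φ (w s i) - Φ (w s j)‖ ^ 2 := by
    intro s
    simp only [Fin.sum_univ_three, h0]
    linarith [hlow s 0 1 (by decide), hlow s 0 2 (by decide), hlow s 1 2 (by decide),
      hlow s 1 0 (by decide), hlow s 2 0 (by decide), hlow s 2 1 (by decide)]
  have hcross' : ∑ i, ∑ j, ‖Φ (w false i) - Φ (w true j)‖ ^ 2 ≤ 9 * r ^ 2 := by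
    simp only [Fin.sum_univ_three]
    linarith [hupp 0 0, hupp 0 1, hupp 0 2, hupp 1 0, hupp 1 1, hupp 1 2, hupp 2 0, hupp 2 1,
      hupp 2 2]
  linarith [hpar' false, hpar' true]

/-! ### Asymptotics -/

theorem four_rpow_le_of_forall_large {α B : ℝ} (k₀ : ℕ)
    (h : ∀ k : ℕ, k₀ ≤ k → 2 * ((2 * k : ℝ) ^ α) ^ 2 ≤ 3 * ((k + B) ^ α) ^ 2) :
    (4 : ℝ) ^ α ≤ 3 / 2 := by
  have hlim : Filter.Tendsto (fun k : ℕ => ((1 + B * (k : ℝ)⁻¹) ^ α) ^ 2) Filter.atTop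
      (nhds (((1 + B * 0) ^ α) ^ 2)) := by
    refine Filter.Tendsto.pow (Filter.Tendsto.rpow_const ?_ (Or.inl (by simp))) 2
    exact (tendsto_inv_atTop_nhds_zero_nat.const_mul B).const_add 1
  have h4 : ((2 : ℝ) ^ α) ^ 2 = 4 ^ α := by
    rw [sq, ← Real.mul_rpow (by norm_num) (by norm_num)]; norm_num
  suffices (4 : ℝ) ^ α ≤ 3 / 2 * ((1 + B * 0) ^ α) ^ 2 by simpa using this
  refine ge_of_tendsto (hlim.const_mul (3 / 2)) ?_
  filter_upwards [Filter.eventually_ge_atTop k₀, Filter.eventually_gt_atTop 0,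
    -- `B` may be negative; `k + B ≥ 0` is needed to split the real power of the product.
    Filter.eventually_ge_atTop ⌈-B⌉₊] with k hk hk0 hkB
  have hk' : (0 : ℝ) < k := by exact_mod_cast hk0
  have hB : 0 ≤ 1 + B * (k : ℝ)⁻¹ := by
    have h1 : 0 ≤ (k : ℝ) + B := by linarith [Nat.ceil_le.1 hkB]
    have h2 : 1 + B * (k : ℝ)⁻¹ = (k + B) * (k : ℝ)⁻¹ := by field_simp
    rw [h2]; positivity
  have hkB' : (k : ℝ) + B = k * (1 + B * (k : ℝ)⁻¹) := by field_simp
  have := h k hk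
  rw [hkB', Real.mul_rpow hk'.le hB, Real.mul_rpow (by norm_num) hk'.le, mul_pow, mul_pow, h4] at this
  have hpos : 0 < ((k : ℝ) ^ α) ^ 2 := by positivity
  refine le_of_mul_le_mul_right ?_ hpos
  linarith

/-- A symmetrization of conditional complexity lying between the minimum and the maximum of the
two values plus `c`, for distinct strings, has non-Euclidean powers for large exponents. -/
theorem not_isEuclidean_rpow {U : List Bool → List Bool →. List Bool}
    (hU : IsOptimalPrefixMachine U) {c α : ℝ} (hc : 0 ≤ c) (hα : Real.logb 4 (3 / 2) < α)
    {d : List Bool → List Bool → ℝ} (hself : ∀ x, d x x = 0)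
    (hlow : ∀ x y (t : ℝ), x ≠ y → t ≤ condK U x y → t ≤ condK U y x → t ≤ d x y)
    (hupp : ∀ x y (t : ℝ), x ≠ y → condK U x y ≤ t → condK U y x ≤ t → d x y ≤ t + c)
    (hnonneg : ∀ x y, 0 ≤ d x y) :
    ¬ IsEuclidean.{0, v} (fun x y => d x y ^ α) := by
  intro hE
  have hα0 : 0 < α := (Real.logb_pos (by norm_num) (by norm_num)).trans hα
  have h4 : 3 / 2 < (4 : ℝ) ^ α := (Real.logb_lt_iff_lt_rpow (by norm_num) (by norm_num)).1 hα
  obtain ⟨b, hb⟩ := hU.exists_condK_lineWord_le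
  obtain ⟨b', hb'⟩ := hU.exists_condK_lineWord_self_le
  -- Here `n = k + 2`, so crossing distances are at most `k + 2 + b + c`; from `k ≥ 2 + b'` on, `n +
  -- b' ≤ 2 * k`, which separates parallel words.
  refine h4.not_ge (four_rpow_le_of_forall_large (B := 2 + b + c) (2 + b') fun k hk => ?_)
  obtain ⟨m, hm⟩ := hU.exists_lt_condK_lineWord k
  refine mul_sq_le_of_isEuclidean hE (fun s i => lineWord s i m) (by positivity) ?_ ?_
  · intro s i j hij
    have hne : lineWord s i m ≠ lineWord s j m := by
      intro heq
      have h1 := hm s i j hij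
      have h2 := hb' _ m s j
      rw [heq] at h1
      omega
    refine Real.rpow_le_rpow (by positivity) (hlow _ _ _ hne ?_ ?_) hα0.le
    · exact_mod_cast (hm s i j hij).le
    · exact_mod_cast (hm s j i hij.symm).le
  · intro i j
    refine Real.rpow_le_rpow (hnonneg _ _) ?_ hα0.le
    -- Crossing words may coincide; distance `0` still meets the upper bound.
    rcases eq_or_ne (lineWord false i m) (lineWord true j m) with heq | hne
    · rw [heq, hself]; positivity
    · refine (hupp _ _ (k + 2 + b) hne ?_ ?_).trans_eq (by ring)
      · exact_mod_cast hb _ m false i j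
      · exact_mod_cast hb _ m true j i

end AlgInfoDistance

theorem mainTheorem6 (U : List Bool → List Bool →. List Bool)
    (hU : AlgInfoDistance.IsOptimalPrefixMachine U) (c : ℝ) (hc : 0 ≤ c)
    (α : ℝ) (hα : Real.logb 4 (3 / 2) < α) :
    ¬ AlgInfoDistance.IsEuclidean.{0, v}
        (fun x y : List Bool => AlgInfoDistance.dKMax U c x y ^ α) ∧
      ¬ AlgInfoDistance.IsEuclidean.{0, v}
        (fun x y : List Bool => AlgInfoDistance.dKAvg U c x y ^ α) := by
  constructor
  · refine AlgInfoDistance.not_isEuclidean_rpow hU hc hα (fun x => if_pos rfl) ?_ ?_ ?_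
    · intro x y t hne h1 _
      rw [AlgInfoDistance.dKMax, if_neg hne]
      exact (h1.trans (le_max_left _ _)).trans (le_add_of_nonneg_right hc)
    · intro x y t hne h1 h2
      rw [AlgInfoDistance.dKMax, if_neg hne]
      gcongr
      exact max_le h1 h2
    · intro x y
      rw [AlgInfoDistance.dKMax]
      split_ifs <;> positivity
  · refine AlgInfoDistance.not_isEuclidean_rpow hU hc hα (fun x => if_pos rfl) ?_ ?_ ?_
    · intro x y t hne h1 h2
      rw [AlgInfoDistance.dKAvg, if_neg hne]
      linarith
    · intro x y t hne h1 h2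
      rw [AlgInfoDistance.dKAvg, if_neg hne]
      linarith
    · intro x y
      rw [AlgInfoDistance.dKAvg]
      split_ifs <;> positivity
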